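/- Let $N=\{1,\dots,n\}$ be a set of $n$ agents and $M$ a finite set of goods. Each agent $i$ has an additive utility function $u_i:2^M\to\mathbb{R}_{\ge 0}$, i.e. $u_i(M')=\sum_{g\in M'}u_i(\{g\})$ for all $M'\subseteq M$. An allocation $\mathcal{A}=(A_1,\dots,A_n)$ is an ordered partition of $M$ into $n$ (possibly empty) bundles; it is $s$-balanced if $|A_i|=s$ for all $i$. It is EF1 if for all distinct $i,j\in N$, either $A_j=\emptyset$ or there is $g\in A_j$ with $u_i(A_i)\ge u_i(A_j\setminus\{g\})$. An exchange transforms an allocation $\mathcal{A}$ into an allocation $\mathcal{B}$ such that, for some distinct $i,j\in N$, $g\in A_i$ and $g'\in A_j$, we have $B_i=(A_i\cup\{g'\})\setminus\{g\}$, $B_j=(A_j\cup\{g\})\setminus\{g'\}$, and $B_k=A_k$ for all $k\ne i,j$. For positive integers $n,s$, let $f(n,s)$ be the smallest non-negative integer such that for every choice of a set of $ns$ goods, utility functions of the $n$ agents, and $s$-balanced allocation $\mathcal{A}$, some EF1 allocation can be reached from $\mathcal{A}$ by a sequence of at most $f(n,s)$ exchanges. Theorem. Let $n$ and $s$ be positive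 integers, and let $q=\lfloor s/n\rfloor$ and $r=s-qn$. Then $f(n,s)$ is well defined (such an integer exists), and $$f(n,s)\le\begin{cases} \dfrac{s(n-1)}{2} & \text{if } r=0,\\[2mm] \dfrac{s(n-1)}{2}+\dfrac{r(n-3)}{2}+1 & \text{otherwise.}\end{cases}$$ Moreover, for every positive integer $s$, $f(2,s)\le (s-r)/2$, where $r=s-2\lfloor s/2\rfloor$. -/

import Mathlib

open scoped NNReal

namespace FairDivision

/-- A fair division instance with set of agents `N` and set of goods `M`: every agent has an
additive utility function from bundles to the non-negative reals. -/
structure Instance (N M : Type) where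
  utility : N → Finset M → ℝ≥0
  additive : ∀ (i : N) (S : Finset M), utility i S = ∑ g ∈ S, utility i {g}

/-- An allocation: an ordered partition of the goods into (possibly empty) bundles,
one for each agent. -/
structure Allocation (N M : Type) where
  bundle : N → Finset M
  partition : ∀ g : M, ∃! i : N, g ∈ bundle i

/-- An allocation is `s`-balanced if every agent has exactly `s` goods. -/
def Allocation.IsBalancedOf {N M : Type} (A : Allocation N M) (s : ℕ) : Prop :=
  ∀ i : N, (A.bundle i).card = s

/-- Agent `i` is EF1 towards agent `j` in the allocation `A`. -/
def Instance.EF1Towards {N M : Type} [DecidableEq M] (I : Instance N M)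
    (A : Allocation N M) (i j : N) : Prop :=
  A.bundle j = ∅ ∨
    ∃ g ∈ A.bundle j, I.utility i (A.bundle i) ≥ I.utility i (A.bundle j \ {g})

/-- An allocation is EF1 if every agent is EF1 towards every other agent. -/
def Instance.IsEF1 {N M : Type} [DecidableEq M] (I : Instance N M)
    (A : Allocation N M) : Prop :=
  ∀ i j : N, i ≠ j → I.EF1Towards A i j

/-- `B` arises from `A` by one exchange: two distinct agents `i`, `j` swap a good `g` of `i`
with a good `g'` of `j`, and all other bundles stay the same. -/
def Exchange {N M : Type} [DecidableEq M] (A B : Allocation N M) : Prop :=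
  ∃ i j : N, i ≠ j ∧ ∃ g ∈ A.bundle i, ∃ g' ∈ A.bundle j,
    B.bundle i = (A.bundle i ∪ {g'}) \ {g} ∧
    B.bundle j = (A.bundle j ∪ {g}) \ {g'} ∧
    ∀ k : N, k ≠ i → k ≠ j → B.bundle k = A.bundle k

/-- `B` can be reached from `A` by a sequence of exactly `T` exchanges.
(Only the terms `0, …, T` of the sequence matter.) -/
def ReachedIn {N M : Type} [DecidableEq M] (A B : Allocation N M) (T : ℕ) : Prop :=
  ∃ σ : ℕ → Allocation N M, σ 0 = A ∧ σ T = B ∧ ∀ t < T, Exchange (σ t) (σ (t + 1))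

/-- `k` exchanges always suffice for `n` agents with `s` goods each: for every instance with `n`
agents and `n * s` goods and every `s`-balanced allocation `A` in it, some EF1 allocation can be
reached from `A` using at most `k` exchanges. -/
def Suffices (n s k : ℕ) : Prop :=
  ∀ (M : Type) [Fintype M] [DecidableEq M], Fintype.card M = n * s →
    ∀ (I : Instance (Fin n) M) (A : Allocation (Fin n) M), A.IsBalancedOf s →
      ∃ B : Allocation (Fin n) M, I.IsEF1 B ∧ ∃ T ≤ k, ReachedIn A B T

/-- The worst-case number `f(n, s)` of exchanges: the smallest `k` such that `k` exchanges
always suffice. -/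
noncomputable def f (n s : ℕ) : ℕ := sInf {k : ℕ | Suffices n s k}

end FairDivision

namespace FairDivision

open Finset

/-! Two questions are separated: which EF1 allocation to aim for, and how few exchanges lead there.
Target. Split each agent's `s = q * n + r` goods into `q` pure groups of `n` goods and `r`
left-overs, and collect all left-overs into `r` mixed groups of `n`. Envy-cycle elimination, run one
group at a time, gives an EF1 allocation in which everyone gets one good of every group
(`exists_ef1_perms`). Cost. Cut the goods into parts in which every agent owns as many goods before
as after. A part costs at most the number of its goods not initially held by a chosen hub agent
(`reachedIn_of_balanced`). The good of agent `i`'s `m`-th pure group meant for `j` pairs with the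
good of `j`'s `m`-th group meant for `i`, so pure groups cost `q * (n * (n - 1) / 2)`. Each mixed
group but the first contains a set of goods that is balanced on its own, which saves one exchange;
everything else forms one part with agent `0` as hub, whose `r` left-overs all lie in the first
mixed group. Mixed groups thus cost `(r - 1) * (n - 1) + (n - r)` if `r > 0`. For two agents a
sharper bound comes from splitting each initial bundle by round robin (`suffices_two`). -/

/-- The allocation in which agent `i` owns the goods `g` with `a g = i`. -/
def Allocation.ofOwner {N M : Type} [Fintype M] [DecidableEq N] (a : M → N) : Allocation N M where
  bundle i := {g | a g = i}
  partition g := ⟨a g, by simp, fun i hi => by simpa [eq_comm] using hi⟩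

/-! ### Counting exchanges between allocations with balanced parts -/

section Reach

theorem ReachedIn.cons {N M : Type} [DecidableEq M] {A B C : Allocation N M} {T : ℕ} (h : Exchange A B)
    (hB : ReachedIn B C T) : ReachedIn A C (T + 1) := by
  obtain ⟨σ, h0, hT, hσ⟩ := hB
  refine ⟨fun t => Nat.casesOn t A σ, rfl, hT, ?_⟩
  rintro (_ | t) ht
  · simpa [h0] using h
  · exact hσ t (by omega)

variable {N M : Type} [Fintype M] [DecidableEq N]

theorem Allocation.exists_eq_ofOwner (A : Allocation N M) :
    ∃ a : M → N, A = Allocation.ofOwner a := by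
  choose a ha hu using A.partition
  refine ⟨a, ?_⟩
  obtain ⟨bundle, h⟩ := A
  have hb : bundle = fun i => univ.filter fun g => a g = i := by
    funext i
    ext g
    simp only [mem_filter, mem_univ, true_and]
    exact ⟨fun hg => (hu g i hg).symm, fun hg => hg ▸ ha g⟩
  subst hb
  rfl

theorem exchange_ofOwner [DecidableEq M] (a : M → N) {g g' : M} (h : a g ≠ a g') :
    Exchange (Allocation.ofOwner a) (Allocation.ofOwner (a ∘ Equiv.swap g g')) := by
  have hne : g ≠ g' := fun e => h (e ▸ rfl)
  refine ⟨a g, a g', h, g, by simp [Allocation.ofOwner], g', by simp [Allocation.ofOwner],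
    ?_, ?_, ?_⟩
  · ext x
    simp only [Allocation.ofOwner, mem_filter, mem_univ, true_and, mem_sdiff, mem_union,
      mem_singleton, Function.comp]
    rcases eq_or_ne x g with rfl | h1
    · simp [h.symm]
    rcases eq_or_ne x g' with rfl | h2
    · simp [h1]
    · simp [Equiv.swap_apply_of_ne_of_ne h1 h2, h1, h2]
  · ext x
    simp only [Allocation.ofOwner, mem_filter, mem_univ, true_and, mem_sdiff, mem_union,
      mem_singleton, Function.comp]
    rcases eq_or_ne x g with rfl | h1
    · simp [hne]
    rcases eq_or_ne x g' with rfl | h2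
    · simp [h]
    · simp [Equiv.swap_apply_of_ne_of_ne h1 h2, h1, h2]
  · intro k hk hk'
    ext x
    simp only [Allocation.ofOwner, mem_filter, mem_univ, true_and, Function.comp]
    rcases eq_or_ne x g with rfl | h1
    · simp [hk.symm, hk'.symm]
    rcases eq_or_ne x g' with rfl | h2
    · simp [hk.symm, hk'.symm]
    · simp [Equiv.swap_apply_of_ne_of_ne h1 h2]

/-- Suppose that on `S` the goods in each part have, with multiplicity, the same owners under `a`
as under `b`, and that `a` and `b` agree outside `S`. Exchanging goods with a fixed agent `v k` in
each part `k`, one reaches `b` from `a` with one exchange at most for each good of `S` that is not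
held by the agent chosen for its part. -/
theorem reachedIn_of_balanced {ι : Type} [DecidableEq M] (part : M → ι) (v : ι → N) (b : M → N) (S : Finset M) (a : M → N)
    (hab : ∀ g ∉ S, a g = b g)
    (hS : S.val.map (fun g => (part g, a g)) = S.val.map (fun g => (part g, b g))) :
    ∃ T ≤ #{g ∈ S | a g ≠ v (part g)},
      ReachedIn (Allocation.ofOwner a) (Allocation.ofOwner b) T := by
  induction hc : #S generalizing S a with
  | zero =>
    obtain rfl : S = ∅ := card_eq_zero.1 hc
    obtain rfl : a = b := funext fun g => hab g (by simp)
    exact ⟨0, by simp, fun _ => Allocation.ofOwner a, rfl, rfl, by simp⟩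
  | succ m ih =>
    -- If this failed, no good of `S` would be held by its hub while every one is destined for it,
    -- contradicting balance.
    obtain ⟨g, hg, hgood⟩ : ∃ g ∈ S, a g ≠ v (part g) → b g ≠ v (part g) := by
      by_contra! hcon
      obtain ⟨g, hg⟩ : S.Nonempty := card_pos.1 (by omega)
      have hmem : (part g, b g) ∈ S.val.map (fun g => (part g, a g)) :=
        hS ▸ Multiset.mem_map_of_mem (fun g => (part g, b g)) hg
      obtain ⟨g', hg', he⟩ := Multiset.mem_map.1 hmem
      simp only [Prod.mk.injEq] at he
      exact (hcon g' hg').1 (by rw [he.1, he.2, (hcon g hg).2])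
    have hcard : #(S.erase g) = m := by rw [card_erase_of_mem hg]; omega
    have hcons : g ::ₘ (S.erase g).val = S.val := by
      rw [erase_val]; exact Multiset.cons_erase hg
    by_cases heq : a g = b g
    · obtain ⟨T, hT, hr⟩ := ih (S.erase g) a
        (fun x hx => by
          by_cases hxg : x = g
          · rw [hxg, heq]
          · exact hab x fun h => hx (mem_erase.2 ⟨hxg, h⟩))
        (by
          rw [← hcons, Multiset.map_cons, Multiset.map_cons, heq] at hS
          exact (Multiset.cons_inj_right _).1 hS) hcard
      exact ⟨T, hT.trans (card_le_card (filter_subset_filter _ (erase_subset _ _))), hr⟩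
    · have hmem : (part g, b g) ∈ S.val.map (fun g => (part g, a g)) :=
        hS ▸ Multiset.mem_map_of_mem (fun g => (part g, b g)) hg
      obtain ⟨g', hg', he⟩ := Multiset.mem_map.1 hmem
      simp only [Prod.mk.injEq] at he
      obtain ⟨hp, hag'⟩ := he
      have hne : g' ≠ g := fun e => heq (by rw [← hag', e])
      have hperm : S.map (Equiv.swap g g').toEmbedding = S :=
        map_perm fun x hx => by
          rcases Equiv.swap_apply_ne_self_iff.1 hx with ⟨-, rfl | rfl⟩ <;> assumption
      have hfun : (fun x => (part x, (a ∘ Equiv.swap g g') x)) =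
          (fun x => (part x, a x)) ∘ Equiv.swap g g' := by
        funext x
        rcases eq_or_ne x g with rfl | h1
        · simp [hp]
        rcases eq_or_ne x g' with rfl | h2
        · simp [hp]
        · simp [Equiv.swap_apply_of_ne_of_ne h1 h2]
      have hS' : S.val.map (fun x => (part x, (a ∘ Equiv.swap g g') x)) =
          S.val.map (fun x => (part x, b x)) := by
        rw [← hS, hfun, ← Multiset.map_map]
        congr 1
        exact congrArg Finset.val hperm
      obtain ⟨T, hT, hr⟩ := ih (S.erase g) (a ∘ Equiv.swap g g')
        (fun x hx => by
          by_cases hxg : x = g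
          · simp [hxg, hag']
          · have hxS : x ∉ S := fun h => hx (mem_erase.2 ⟨hxg, h⟩)
            have hxg' : x ≠ g' := fun h => hxS (h ▸ hg')
            simp [Equiv.swap_apply_of_ne_of_ne hxg hxg', hab x hxS])
        (by
          rw [← hcons, Multiset.map_cons, Multiset.map_cons] at hS'
          have : (a ∘ Equiv.swap g g') g = b g := by simp [hag']
          rw [this] at hS'
          exact (Multiset.cons_inj_right _).1 hS') hcard
      refine ⟨T + 1, ?_, hr.cons (exchange_ofOwner a (by rw [hag']; exact heq))⟩
      refine (Nat.add_le_add_right hT 1).trans ?_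
      rw [Nat.add_one_le_iff]
      -- The exchange settles `g`. If the hub held `g`, it now holds `g'`, which was counted before;
      -- otherwise `g` was counted and leaves `S`, while `g'` was counted already, since its owner
      -- `b g` is not the hub.
      by_cases hv : a g = v (part g)
      · apply card_lt_card
        refine Finset.ssubset_iff_subset_ne.2 ⟨fun x hx => ?_, fun e => ?_⟩
        · simp only [mem_filter, mem_erase, Function.comp] at hx ⊢
          rcases eq_or_ne x g' with rfl | h2
          · exact ⟨hg', fun e => hx.2 (by simp [hv, hp])⟩
          · rw [Equiv.swap_apply_of_ne_of_ne hx.1.1 h2] at hx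
            exact ⟨hx.1.2, hx.2⟩
        · have : g' ∈ S.filter fun x => a x ≠ v (part x) := by
            refine mem_filter.2 ⟨hg', fun h => heq ?_⟩
            rw [hag', hp] at h
            exact hv.trans h.symm
          rw [← e] at this
          simp [hv, hp] at this
      · apply card_lt_card
        refine Finset.ssubset_iff_subset_ne.2 ⟨fun x hx => ?_, fun e => ?_⟩
        · simp only [mem_filter, mem_erase, Function.comp] at hx ⊢
          rcases eq_or_ne x g' with rfl | h2
          · exact ⟨hg', by rw [hag', hp]; exact hgood hv⟩
          · rw [Equiv.swap_apply_of_ne_of_ne hx.1.1 h2] at hx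
            exact ⟨hx.1.2, hx.2⟩
        · have : g ∈ S.filter fun x => a x ≠ v (part x) := by simp [hg, hv]
          rw [← e] at this
          simp at this

end Reach

/-! ### Envy-cycle elimination and EF1 within groups -/

section EF1

variable {N T : Type}

/-- Iterated images of a finite set shrink until they stabilise. On the stable set `p` is a
permutation: this yields both envy cycles and balanced subsets of mixed groups. -/
theorem exists_subset_image_eq [DecidableEq N] (p : N → N) (S : Finset N) (hS : S.Nonempty)
    (hp : ∀ x ∈ S, p x ∈ S) : ∃ P ⊆ S, P.Nonempty ∧ P.image p = P := by
  induction S using Finset.strongInduction with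
  | H S ih =>
    have hsub : S.image p ⊆ S := image_subset_iff.2 hp
    by_cases h : S.image p = S
    · exact ⟨S, Subset.rfl, hS, h⟩
    · obtain ⟨P, hP, hne, him⟩ := ih (S.image p) (hsub.ssubset_of_ne h) (hS.image p)
        (fun x hx => mem_image_of_mem p (hsub hx))
      exact ⟨P, hP.trans hsub, hne, him⟩

/-- Envy cycle elimination: with `V i j` the value of bundle `j` for agent `i`, the bundles can be
permuted such that nobody is worse off and there is no cycle of envy any more. -/
theorem exists_perm_unenvied [Fintype N] [DecidableEq N] (V : N → N → ℝ≥0) :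
    ∃ ρ : Equiv.Perm N, (∀ i, V i i ≤ V i (ρ i)) ∧
      ∀ S : Finset N, S.Nonempty → ∃ j ∈ S, ∀ i ∈ S, V i (ρ j) ≤ V i (ρ i) := by
  classical
  obtain ⟨ρ, hρ, hmax⟩ := exists_max_image
    ({ρ | ∀ i, V i i ≤ V i (ρ i)} : Finset (Equiv.Perm N)) (fun ρ => ∑ i, V i (ρ i))
    ⟨1, by simp⟩
  simp only [mem_filter, mem_univ, true_and] at hρ hmax
  refine ⟨ρ, hρ, fun S hS => ?_⟩
  by_contra! hcon
  -- `p` sends each agent of `S` to one in `S` who envies it. On `P` it is a permutation, so giving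
  -- `x`'s bundle to `p x` raises the total value, against maximality.
  have hp : ∀ j : N, ∃ i : N, j ∈ S → i ∈ S ∧ V i (ρ i) < V i (ρ j) := fun j => by
    by_cases hj : j ∈ S
    · obtain ⟨i, hi⟩ := hcon j hj
      exact ⟨i, fun _ => hi⟩
    · exact ⟨j, fun h => absurd h hj⟩
  choose p hp using hp
  obtain ⟨P, hPS, ⟨x₀, hx₀⟩, him⟩ := exists_subset_image_eq p S hS fun x hx => (hp x hx).1
  have hinj : Set.InjOn p P := card_image_iff.1 (by rw [him])
  have hmem : ∀ x ∈ P, p x ∈ P := fun x hx => him ▸ mem_image_of_mem p hx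
  let f : N → N := fun x => if x ∈ P then p x else x
  have hf : Function.Injective f := by
    intro x y hxy
    by_cases hx : x ∈ P <;> by_cases hy : y ∈ P <;> simp only [f, hx, hy, if_true, if_false] at hxy
    · exact hinj hx hy hxy
    · exact absurd (hxy ▸ hmem x hx) hy
    · exact absurd (hxy ▸ hmem y hy) hx
    · exact hxy
  let π : Equiv.Perm N := Equiv.ofBijective f (Finite.injective_iff_bijective.1 hf)
  have hle : ∀ x, V (π x) (ρ (π x)) ≤ V (π x) (ρ x) := fun x => by
    by_cases hx : x ∈ P
    · simpa [π, f, hx] using (hp x (hPS hx)).2.le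
    · simp [π, f, hx]
  have hlt : ∑ i, V i (ρ i) < ∑ i, V i ((π.symm.trans ρ) i) := by
    rw [← Equiv.sum_comp π, ← Equiv.sum_comp π (fun i => V i ((π.symm.trans ρ) i))]
    refine sum_lt_sum (fun x _ => by simpa using hle x) ⟨x₀, mem_univ _, ?_⟩
    have hlt₀ : V (π x₀) (ρ (π x₀)) < V (π x₀) (ρ x₀) := by
      simpa [π, f, hx₀] using (hp x₀ (hPS hx₀)).2
    simpa using hlt₀
  refine absurd (hmax (π.symm.trans ρ) fun i => ?_) hlt.not_ge
  exact (hρ i).trans (by simpa using hle (π.symm i))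

/-- If every set of agents has a member that nobody in the set envies, then the agents can pick goods
one after another such that nobody prefers the pick of an agent they envy. -/
theorem exists_injOn_picks [DecidableEq N] {G : Type} [DecidableEq G] (R : N → N → Prop)
    (hR : ∀ S : Finset N, S.Nonempty → ∃ j ∈ S, ∀ i ∈ S, ¬ R i j) (w : N → G → ℝ≥0)
    (S : Finset N) (C : Finset G) (hSC : #S = #C) [Nonempty G] :
    ∃ τ : N → G, (∀ i ∈ S, τ i ∈ C) ∧ Set.InjOn τ S ∧
      ∀ i ∈ S, ∀ j ∈ S, R i j → w i (τ j) ≤ w i (τ i) := by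
  induction hm : #S generalizing S C with
  | zero =>
    obtain rfl : S = ∅ := card_eq_zero.1 hm
    exact ⟨fun _ => Classical.arbitrary G, by simp⟩
  | succ m ih =>
    -- An agent nobody in `S` envies picks first, so enviers always pick before those they envy.
    obtain ⟨j, hj, hun⟩ := hR S (card_pos.1 (by omega))
    obtain ⟨c, hc, hbest⟩ := exists_max_image C (w j) (card_pos.1 (by omega))
    obtain ⟨τ, h1, h2, h3⟩ := ih (S.erase j) (C.erase c)
      (by rw [card_erase_of_mem hj, card_erase_of_mem hc, hSC])
      (by rw [card_erase_of_mem hj]; omega)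
    have hτ : ∀ i ∈ S, i ≠ j → τ i ∈ C.erase c := fun i hi hij => h1 i (mem_erase.2 ⟨hij, hi⟩)
    refine ⟨Function.update τ j c, fun i hi => ?_, fun x hx y hy hxy => ?_, fun i hi k hk hik => ?_⟩
    · rcases eq_or_ne i j with hij | hij
      · simpa [hij] using hc
      · simpa [hij] using mem_of_mem_erase (hτ i hi hij)
    · rcases eq_or_ne x j with hxj | hxj <;> rcases eq_or_ne y j with hyj | hyj
      · rw [hxj, hyj]
      · simp only [hxj, Function.update_self, Function.update_of_ne hyj] at hxy
        exact absurd hxy.symm (ne_of_mem_erase (hτ y hy hyj))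
      · simp only [hyj, Function.update_self, Function.update_of_ne hxj] at hxy
        exact absurd hxy (ne_of_mem_erase (hτ x hx hxj))
      · simp only [Function.update_of_ne hxj, Function.update_of_ne hyj] at hxy
        exact h2 (by simpa [hxj] using hx) (by simpa [hyj] using hy) hxy
    · rcases eq_or_ne k j with hkj | hkj
      · exact absurd (hkj ▸ hik) (hun i hi)
      rcases eq_or_ne i j with hij | hij
      · simpa [hij, hkj] using hbest _ (mem_of_mem_erase (hτ k hk hkj))
      · simpa [hkj, hij] using h3 i (mem_erase.2 ⟨hij, hi⟩) k (mem_erase.2 ⟨hkj, hk⟩) hik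

/-- For goods in groups of the size of the set of agents, there is an allocation that gives every
agent one good of every group and is EF1. Here `w i t k` is the value for agent `i` of the `k`-th
good of group `t`, and agent `i` gets the good `σ t i` of group `t`. -/
theorem exists_ef1_perms [Fintype N] [DecidableEq N] [DecidableEq T] (w : N → T → N → ℝ≥0)
    (S : Finset T) :
    ∃ σ : T → Equiv.Perm N, ∀ i j, S.Nonempty →
      ∃ t₀ ∈ S, ∑ t ∈ S.erase t₀, w i t (σ t j) ≤ ∑ t ∈ S, w i t (σ t i) := by
  induction S using Finset.induction_on with
  | empty => exact ⟨fun _ => 1, by simp⟩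
  | insert t S ht ih =>
    obtain ⟨σ, hσ⟩ := ih
    rcases isEmpty_or_nonempty N with hN | hN
    · exact ⟨σ, fun i => isEmptyElim i⟩
    obtain ⟨ρ, h1, h2⟩ := exists_perm_unenvied fun i j => ∑ t ∈ S, w i t (σ t j)
    obtain ⟨τ, -, h4, h5⟩ := exists_injOn_picks
      (fun i j => ∑ t ∈ S, w i t (σ t (ρ i)) < ∑ t ∈ S, w i t (σ t (ρ j)))
      (by simpa using h2) (fun i k => w i t k) univ univ rfl
    let τ' : Equiv.Perm N := Equiv.ofBijective τ
      (Finite.injective_iff_bijective.1 fun x y h => h4 (by simp) (by simp) h)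
    let σ' : T → Equiv.Perm N := Function.update (fun t => ρ.trans (σ t)) t τ'
    have hσt : ∀ i, σ' t i = τ i := fun i => by simp [σ', τ']
    have hσs : ∀ s ∈ S, ∀ i, σ' s i = σ s (ρ i) := fun s hs i => by
      have : s ≠ t := fun e => ht (e ▸ hs)
      simp [σ', this]
    have hsum : ∀ i j, ∑ s ∈ S, w i s (σ' s j) = ∑ s ∈ S, w i s (σ s (ρ j)) := fun i j =>
      sum_congr rfl fun s hs => by rw [hσs s hs]
    refine ⟨σ', fun i j _ => ?_⟩
    rw [sum_insert ht, hσt, hsum]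
    -- With envy, the new good of `i` beats that of `j` and the old removal still works; without it,
    -- removing the new good of `j` suffices.
    by_cases henvy : ∑ s ∈ S, w i s (σ s (ρ i)) < ∑ s ∈ S, w i s (σ s (ρ j))
    · have hSne : S.Nonempty := by
        rw [nonempty_iff_ne_empty]
        rintro rfl
        simp at henvy
      obtain ⟨t₀, ht₀, hle⟩ := hσ i (ρ j) hSne
      have hne : t ≠ t₀ := fun e => ht (e ▸ ht₀)
      refine ⟨t₀, mem_insert_of_mem ht₀, ?_⟩
      rw [erase_insert_of_ne hne, sum_insert (fun h => ht (mem_of_mem_erase h)), hσt]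
      refine add_le_add (h5 i (mem_univ _) j (mem_univ _) henvy) ?_
      rw [sum_congr rfl fun s hs => by rw [hσs s (mem_of_mem_erase hs)]]
      exact hle.trans (h1 i)
    · refine ⟨t, mem_insert_self _ _, ?_⟩
      rw [erase_insert ht, hsum]
      exact (not_lt.1 henvy).trans (le_add_of_nonneg_left zero_le)

end EF1

theorem map_pair_eq_of_card {ι N M : Type} [DecidableEq ι] [DecidableEq N] (S : Finset M)
    (part : M → ι) (a b : M → N)
    (h : ∀ k i, #{g ∈ S | part g = k ∧ a g = i} = #{g ∈ S | part g = k ∧ b g = i}) :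
    S.val.map (fun g => (part g, a g)) = S.val.map (fun g => (part g, b g)) := by
  ext ⟨k, i⟩
  have := h k i
  simp only [Multiset.count_map, Prod.mk.injEq, card_def, filter_val] at this ⊢
  simpa only [eq_comm] using this

theorem Instance.utility_union {N M : Type} [DecidableEq M] (I : Instance N M) (i : N)
    {S S' : Finset M} (h : Disjoint S S') :
    I.utility i (S ∪ S') = I.utility i S + I.utility i S' := by
  rw [I.additive i (S ∪ S'), I.additive i S, I.additive i S', sum_union h]

/-! ### Two agents: round robin inside each bundle -/

section TwoAgents

/-- Two agents `i` and `j` pick goods from `C` in turns, starting with `i`. -/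
theorem Instance.exists_roundRobin {N M : Type} [DecidableEq M] (I : Instance N M) (i j : N)
    (C : Finset M) :
    ∃ X Y : Finset M, Disjoint X Y ∧ X ∪ Y = C ∧ #X = (#C + 1) / 2 ∧ #Y = #C / 2 ∧
      I.utility i Y ≤ I.utility i X ∧
      (C.Nonempty → ∃ g ∈ X, I.utility j (X.erase g) ≤ I.utility j Y) := by
  induction hm : #C generalizing C i j with
  | zero =>
    obtain rfl : C = ∅ := card_eq_zero.1 hm
    exact ⟨∅, ∅, by simp⟩
  | succ m ih =>
    obtain ⟨c, hc, hbest⟩ := exists_max_image C (fun g => I.utility i {g}) (card_pos.1 (by omega))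
    obtain ⟨X, Y, hd, hu, hX, hY, hj, hi⟩ := ih j i (C.erase c) (by rw [card_erase_of_mem hc, hm]; rfl)
    have hcX : c ∉ X := fun h => by simpa [hu] using mem_union_left Y h
    have hcY : c ∉ Y := fun h => by simpa [hu] using mem_union_right X h
    refine ⟨insert c Y, X, ?_, ?_, ?_, ?_, ?_, fun _ => ⟨c, mem_insert_self _ _, ?_⟩⟩
    · exact disjoint_insert_left.2 ⟨hcX, hd.symm⟩
    · rw [insert_union, union_comm, hu, insert_erase hc]
    · rw [card_insert_of_notMem hcY, hY]; omega
    · rw [hX]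
    · rw [insert_eq, I.utility_union i (disjoint_singleton_left.2 hcY)]
      rcases (C.erase c).eq_empty_or_nonempty with h0 | h0
      · have : X = ∅ := by
          rw [h0, union_eq_empty] at hu
          exact hu.1
        rw [this, I.additive i ∅]
        simp
      · obtain ⟨g, hg, hle⟩ := hi h0
        rw [← insert_erase hg, insert_eq,
          I.utility_union i (disjoint_singleton_left.2 (notMem_erase g X))]
        exact add_le_add (hbest g (mem_of_mem_erase (hu ▸ mem_union_left Y hg))) hle
    · rw [erase_insert hcY]
      exact hj

/-- Each agent picks first in its own bundle, and the second picks `Y₀`, `Y₁` are swapped. An agent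
has no envy within its own old bundle and is EF1 within the other, so removing one good suffices
overall. -/
theorem suffices_two {s : ℕ} (hs : 0 < s) : Suffices 2 s (s / 2) := by
  intro M _ _ _ I A hA
  obtain ⟨a, rfl⟩ := A.exists_eq_ofOwner
  obtain ⟨X₀, Y₀, hd₀, hu₀, -, hY₀, hle₀, hef₀⟩ := I.exists_roundRobin 0 1 {g | a g = 0}
  obtain ⟨X₁, Y₁, hd₁, hu₁, -, hY₁, hle₁, hef₁⟩ := I.exists_roundRobin 1 0 {g | a g = 1}
  have hc₀ : #{g | a g = 0} = s := hA 0
  have hc₁ : #{g | a g = 1} = s := hA 1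
  rw [hc₀] at hY₀
  rw [hc₁] at hY₁
  obtain ⟨g₀, hg₀, hg₀le⟩ := hef₀ (card_pos.1 (by omega))
  obtain ⟨g₁, hg₁, hg₁le⟩ := hef₁ (card_pos.1 (by omega))
  have aX₀ : ∀ g ∈ X₀, a g = 0 := fun g hg => by
    have := mem_union_left Y₀ hg; rw [hu₀] at this; simpa using this
  have aY₀ : ∀ g ∈ Y₀, a g = 0 := fun g hg => by
    have := mem_union_right X₀ hg; rw [hu₀] at this; simpa using this
  have aX₁ : ∀ g ∈ X₁, a g = 1 := fun g hg => by
    have := mem_union_left Y₁ hg; rw [hu₁] at this; simpa using this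
  have aY₁ : ∀ g ∈ Y₁, a g = 1 := fun g hg => by
    have := mem_union_right X₁ hg; rw [hu₁] at this; simpa using this
  have h01 : (0 : Fin 2) ≠ 1 := by decide
  have hdisj : ∀ {U V : Finset M}, (∀ g ∈ U, a g = 0) → (∀ g ∈ V, a g = 1) → Disjoint U V :=
    fun hU hV => disjoint_left.2 fun g h h' => h01 ((hU g h).symm.trans (hV g h'))
  let b : M → Fin 2 := fun g => if g ∈ X₀ ∪ Y₁ then 0 else 1
  have hcover : ∀ g, g ∈ X₀ ∨ g ∈ Y₀ ∨ g ∈ X₁ ∨ g ∈ Y₁ := fun g => by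
    have h0 : g ∈ X₀ ∪ Y₀ ↔ a g = 0 := by rw [hu₀]; simp
    have h1 : g ∈ X₁ ∪ Y₁ ↔ a g = 1 := by rw [hu₁]; simp
    rw [mem_union] at h0 h1
    have : a g = 0 ∨ a g = 1 := by omega
    tauto
  have bX₀ : ∀ g ∈ X₀, b g = 0 := fun g hg => if_pos (mem_union_left _ hg)
  have bY₁ : ∀ g ∈ Y₁, b g = 0 := fun g hg => if_pos (mem_union_right _ hg)
  have bY₀ : ∀ g ∈ Y₀, b g = 1 := fun g hg => if_neg fun h => by
    rcases mem_union.1 h with h | h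
    · exact disjoint_left.1 hd₀ h hg
    · exact disjoint_left.1 (hdisj aY₀ aY₁) hg h
  have bX₁ : ∀ g ∈ X₁, b g = 1 := fun g hg => if_neg fun h => by
    rcases mem_union.1 h with h | h
    · exact disjoint_left.1 (hdisj aX₀ aX₁) h hg
    · exact disjoint_left.1 hd₁ hg h
  have hB₀ : (Allocation.ofOwner b).bundle 0 = X₀ ∪ Y₁ := by
    ext g
    simp [Allocation.ofOwner, b]
    tauto
  have hB₁ : (Allocation.ofOwner b).bundle 1 = Y₀ ∪ X₁ := by
    ext g
    simp only [Allocation.ofOwner, mem_filter, mem_univ, true_and, mem_union]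
    refine ⟨fun h => ?_, fun h => h.elim (bY₀ g) (bX₁ g)⟩
    rcases hcover g with h' | h' | h' | h'
    · exact absurd ((bX₀ g h').symm.trans h) h01
    · exact Or.inl h'
    · exact Or.inr h'
    · exact absurd ((bY₁ g h').symm.trans h) h01
  refine ⟨Allocation.ofOwner b, ?_, ?_⟩
  · have hE₀ : I.EF1Towards (Allocation.ofOwner b) 0 1 := by
      refine Or.inr ⟨g₁, by rw [hB₁]; exact mem_union_right _ hg₁, ?_⟩
      have : (Y₀ ∪ X₁) \ {g₁} = Y₀ ∪ X₁.erase g₁ := by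
        rw [← erase_eq, erase_union_distrib,
          erase_eq_of_notMem fun h => disjoint_left.1 (hdisj aY₀ aX₁) h hg₁]
      rw [hB₀, hB₁, this, I.utility_union 0 (hdisj aX₀ aY₁), I.utility_union 0
        (hdisj aY₀ fun g hg => aX₁ g (mem_of_mem_erase hg))]
      exact add_le_add hle₀ hg₁le
    have hE₁ : I.EF1Towards (Allocation.ofOwner b) 1 0 := by
      refine Or.inr ⟨g₀, by rw [hB₀]; exact mem_union_left _ hg₀, ?_⟩
      have : (X₀ ∪ Y₁) \ {g₀} = X₀.erase g₀ ∪ Y₁ := by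
        rw [← erase_eq, erase_union_distrib,
          erase_eq_of_notMem (s := Y₁) fun h => disjoint_left.1 (hdisj aX₀ aY₁) hg₀ h]
      rw [hB₀, hB₁, this, I.utility_union 1 (hdisj aY₀ aX₁), I.utility_union 1
        (hdisj (fun g hg => aX₀ g (mem_of_mem_erase hg)) aY₁)]
      exact add_le_add hg₀le hle₁
    intro i j hij
    have : i = 0 ∧ j = 1 ∨ i = 1 ∧ j = 0 := by omega
    rcases this with ⟨rfl, rfl⟩ | ⟨rfl, rfl⟩
    exacts [hE₀, hE₁]
  · have hYY : Disjoint Y₀ Y₁ := hdisj aY₀ aY₁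
    have hfilter : ∀ (c : M → Fin 2) (x y i : Fin 2), (∀ g ∈ Y₀, c g = x) → (∀ g ∈ Y₁, c g = y) →
        #{g ∈ Y₀ ∪ Y₁ | c g = i} = (if x = i then s / 2 else 0) + if y = i then s / 2 else 0 := by
      intro c x y i hx hy
      rw [filter_union, card_union_of_disjoint (disjoint_filter_filter hYY)]
      congr 1
      · split_ifs with h
        · rw [filter_true_of_mem fun g hg => (hx g hg).trans h, hY₀]
        · rw [filter_false_of_mem fun g hg e => h ((hx g hg).symm.trans e), card_empty]
      · split_ifs with h
        · rw [filter_true_of_mem fun g hg => (hy g hg).trans h, hY₁]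
        · rw [filter_false_of_mem fun g hg e => h ((hy g hg).symm.trans e), card_empty]
    obtain ⟨T, hT, hr⟩ := reachedIn_of_balanced (fun _ => ()) (fun _ => (0 : Fin 2)) b (Y₀ ∪ Y₁) a
      (fun g hg => by
        simp only [mem_union, not_or] at hg
        rcases hcover g with h | h | h | h
        · rw [aX₀ g h, bX₀ g h]
        · exact absurd h hg.1
        · rw [aX₁ g h, bX₁ g h]
        · exact absurd h hg.2)
      (map_pair_eq_of_card _ _ _ _ fun _ i => by
        simp only [true_and]
        rw [hfilter a 0 1 i aY₀ aY₁, hfilter b 1 0 i bY₀ bY₁, add_comm])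
    refine ⟨T, hT.trans (le_of_eq ?_), hr⟩
    rw [filter_congr (q := fun g => a g = 1) fun g _ => by omega,
      hfilter a 0 1 1 aY₀ aY₁]
    simp

end TwoAgents

/-! ### EF1 allocations compatible with given groups -/

section Groups

variable {N M T : Type} [Fintype N] [DecidableEq N] [Fintype M] [DecidableEq M] [Fintype T]
  [DecidableEq T]

theorem Instance.exists_isEF1_of_groups (I : Instance N M) (E : M ≃ T × N) :
    ∃ E' : M ≃ T × N, (∀ g, (E' g).1 = (E g).1) ∧
      I.IsEF1 (Allocation.ofOwner fun g => (E' g).2) := by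
  obtain ⟨σ, hσ⟩ := exists_ef1_perms (fun i t k => I.utility i {E.symm (t, k)}) univ
  let E' : M ≃ T × N := E.trans (Equiv.prodShear (Equiv.refl T) fun t => (σ t).symm)
  have hE' : ∀ t i, E'.symm (t, i) = E.symm (t, σ t i) := fun t i => by
    rw [Equiv.symm_apply_eq]
    simp [E']
  let emb : N → T ↪ M := fun i => ⟨fun t => E.symm (t, σ t i), fun t t' h => by simpa using congrArg (fun g => (E g).1) h⟩
  have hbundle : ∀ i, (Allocation.ofOwner fun g => (E' g).2).bundle i = univ.map (emb i) := by
    intro i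
    ext g
    simp only [Allocation.ofOwner, mem_filter, mem_univ, true_and, mem_map, emb,
      Function.Embedding.coeFn_mk, ← hE']
    exact ⟨fun h => ⟨(E' g).1, by rw [← h]; simp⟩, by rintro ⟨t, rfl⟩; simp⟩
  refine ⟨E', fun g => by simp [E'], fun i j _ => ?_⟩
  rw [Instance.EF1Towards, hbundle, hbundle]
  rcases isEmpty_or_nonempty T with hT | hT
  · exact Or.inl (by simp)
  obtain ⟨t₀, -, hle⟩ := hσ i j univ_nonempty
  refine Or.inr ⟨emb j t₀, mem_map_of_mem _ (mem_univ _), ?_⟩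
  rw [← erase_eq, ← map_erase, I.additive i (map _ _), I.additive i (map _ (erase _ _)), sum_map,
    sum_map]
  exact hle

end Groups

/-! ### Pure and mixed groups, and their balanced parts -/

section Parts

/-- Every agent's `q * n + r` goods are divided into `q` groups of `n` goods each and `r` left-over
goods; the left-over goods of all agents are divided into `r` groups of `n` goods each, such that
all those of agent `0` are in the first one. -/
theorem exists_groups {n q r : ℕ} (hr : r < n) {M : Type} [Fintype M] (a : M → Fin n)
    (ha : ∀ i, #{g | a g = i} = q * n + r) :
    ∃ E : M ≃ ((Fin n × Fin q) ⊕ Fin r) × Fin n,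
      (∀ g i m, (E g).1 = Sum.inl (i, m) → a g = i) ∧
      ∀ g t, (E g).1 = Sum.inr t → (a g).val = 0 → t.val = 0 := by
  let ef : ∀ i, {g // a g = i} ≃ Fin (q * n + r) := fun i =>
    Fintype.equivFinOfCardEq (by rw [Fintype.card_subtype]; exact ha i)
  let e₁ : M ≃ Fin n × Fin (q * n + r) := (Equiv.sigmaFiberEquiv a).symm.trans
    ((Equiv.sigmaCongrRight ef).trans (Equiv.sigmaEquivProd _ _))
  let e₂ : Fin (q * n + r) ≃ (Fin q × Fin n) ⊕ Fin r :=
    finSumFinEquiv.symm.trans (Equiv.sumCongr finProdFinEquiv.symm (Equiv.refl _))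
  -- Left-overs are listed agent by agent and cut into blocks of `n`; as `r < n`, those of agent `0`
  -- fit into the first block.
  let e₃ : Fin n × Fin r ≃ Fin r × Fin n :=
    (finProdFinEquiv.trans (finCongr (mul_comm n r))).trans finProdFinEquiv.symm
  let e₄ : Fin n × ((Fin q × Fin n) ⊕ Fin r) ≃ ((Fin n × Fin q) ⊕ Fin r) × Fin n :=
    (Equiv.prodSumDistrib _ _ _).trans
      ((Equiv.sumCongr (Equiv.prodAssoc _ _ _).symm e₃).trans (Equiv.sumProdDistrib _ _ _).symm)
  have h₁ : ∀ g, (e₁ g).1 = a g := fun g => rfl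
  refine ⟨e₁.trans ((Equiv.prodCongr (Equiv.refl _) e₂).trans e₄), fun g i m h => ?_,
    fun g t h h0 => ?_⟩
  · rw [← h₁]
    simp only [Equiv.trans_apply, Equiv.prodCongr_apply] at h
    generalize e₁ g = x at h
    obtain ⟨j, x⟩ := x
    simp only [Prod.map, Equiv.refl_apply] at h
    generalize e₂ x = y at h
    rcases y with y | y
    · simp [e₄] at h
      exact h.1
    · simp [e₄] at h
  · rw [← h₁] at h0
    simp only [Equiv.trans_apply, Equiv.prodCongr_apply] at h
    generalize e₁ g = x at h h0
    obtain ⟨j, x⟩ := x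
    simp only [Prod.map, Equiv.refl_apply] at h h0
    generalize e₂ x = y at h
    rcases y with y | y
    · simp [e₄] at h
    · simp [e₄, e₃] at h
      rw [← h]
      simp [h0, Fin.divNat, Nat.div_eq_of_lt (y.2.trans hr)]

variable {n q r : ℕ}

theorem exists_balanced_parts (hr : r < n) (a : ((Fin n × Fin q) ⊕ Fin r) × Fin n → Fin n)
    (h₁ : ∀ i m j, a (Sum.inl (i, m), j) = i)
    (h₂ : ∀ t j, (a (Sum.inr t, j)).val = 0 → t.val = 0)
    (ha : ∀ i, #{x | a x = i} = q * n + r) :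
    ∃ (part : ((Fin n × Fin q) ⊕ Fin r) × Fin n → Option ((Fin n × Fin n × Fin q) ⊕ Fin r))
      (v : Option ((Fin n × Fin n × Fin q) ⊕ Fin r) → Fin n),
      (∀ k i, #{x | part x = k ∧ a x = i} = #{x | part x = k ∧ x.2 = i}) ∧
      #{x | a x ≠ v (part x)} ≤
        q * (n * (n - 1) / 2) + ((r - 1) * (n - 1) + if r = 0 then 0 else n - r) := by
  have hn : 0 < n := by omega
  let z : Fin n := ⟨0, hn⟩
  have hP : ∀ t : Fin r, ∃ P : Finset (Fin n), P.Nonempty ∧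
      P.image (fun j => a (Sum.inr t, j)) = P := fun t => by
    obtain ⟨P, -, h⟩ := exists_subset_image_eq (fun j => a (Sum.inr t, j)) univ ⟨z, mem_univ z⟩
      (by simp)
    exact ⟨P, h⟩
  choose P hPne hPim using hP
  choose c hc using hPne
  -- `P t` is permuted by the map from new to old owner, so its goods are balanced. The part `none`
  -- takes the rest.
  let part : ((Fin n × Fin q) ⊕ Fin r) × Fin n → Option ((Fin n × Fin n × Fin q) ⊕ Fin r)
    | (Sum.inl (i, m), j) => some (Sum.inl (min i j, max i j, m))
    | (Sum.inr t, j) => if t.val ≠ 0 ∧ j ∈ P t then some (Sum.inr t) else none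
  let v : Option ((Fin n × Fin n × Fin q) ⊕ Fin r) → Fin n
    | none => z
    | some (Sum.inl (x, _, _)) => x
    | some (Sum.inr t) => c t
  refine ⟨part, v, ?_, ?_⟩
  · have hsome : ∀ k i, #{x | part x = some k ∧ a x = i} = #{x | part x = some k ∧ x.2 = i} := by
      rintro (⟨y, y', m⟩ | t) i
      · let f : ((Fin n × Fin q) ⊕ Fin r) × Fin n → ((Fin n × Fin q) ⊕ Fin r) × Fin n
          | (Sum.inl (i, m), j) => (Sum.inl (j, m), i)
          | x => x
        refine card_nbij' f f ?_ ?_ ?_ ?_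
        · rintro ⟨⟨i', m'⟩ | t, j⟩ hx
          · simp [part, f, h₁] at hx ⊢
            simpa [min_comm, max_comm] using hx
          · simp [part] at hx
        · rintro ⟨⟨i', m'⟩ | t, j⟩ hx
          · simp [part, f, h₁] at hx ⊢
            simpa [min_comm, max_comm] using hx
          · simp [part] at hx
        · rintro ⟨⟨i', m'⟩ | t, j⟩ hx <;> rfl
        · rintro ⟨⟨i', m'⟩ | t, j⟩ hx <;> rfl
      · have hinj : Set.InjOn (fun j => a (Sum.inr t, j)) (P t) :=
          card_image_iff.1 (by rw [hPim])
        refine card_nbij (fun x => (x.1, a x)) ?_ ?_ ?_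
        · rintro ⟨⟨i', m'⟩ | t', j⟩ hx
          · simp [part] at hx
          · simp [part] at hx ⊢
            obtain ⟨⟨⟨h0, hj⟩, rfl⟩, hi⟩ := hx
            refine ⟨⟨⟨h0, ?_⟩, rfl⟩, hi⟩
            nth_rw 1 [← hPim t']
            exact mem_image_of_mem (fun j => a (Sum.inr t', j)) hj
        · rintro ⟨⟨i', m'⟩ | t', j⟩ hx ⟨⟨i'', m''⟩ | t'', j'⟩ hx' he
          · simp [part] at hx
          · simp [part] at hx
          · simp [part] at hx'
          · simp [part] at hx hx'
            obtain ⟨⟨⟨h0, hj⟩, rfl⟩, hi⟩ := hx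
            obtain ⟨⟨⟨h0', hj'⟩, rfl⟩, hi'⟩ := hx'
            rw [hinj hj hj' (hi.trans hi'.symm)]
        · rintro ⟨⟨i', m'⟩ | t', j⟩ hx
          · simp [part] at hx
          · simp [part] at hx
            obtain ⟨⟨⟨h0, hj⟩, rfl⟩, rfl⟩ := hx
            rw [← hPim t'] at hj
            obtain ⟨j', hj', he⟩ := mem_image.1 hj
            exact ⟨(Sum.inr t', j'), by simp [part, h0, hj', he], by simp [he]⟩
    rintro (_ | k) i
    -- The part `none` is balanced because the whole and all other parts are.
    · have hb : #{x : ((Fin n × Fin q) ⊕ Fin r) × Fin n | x.2 = i} = q * n + r := by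
        rw [show ({x : ((Fin n × Fin q) ⊕ Fin r) × Fin n | x.2 = i} : Finset _) =
          (univ : Finset ((Fin n × Fin q) ⊕ Fin r)) ×ˢ {i} by
            ext
            simp only [mem_filter, mem_product, mem_univ, mem_singleton, true_and], card_product]
        simp [mul_comm]
      have htot : #{x | a x = i} = #{x : ((Fin n × Fin q) ⊕ Fin r) × Fin n | x.2 = i} := by
        rw [ha, hb]
      have hsplit : ∀ (p : ((Fin n × Fin q) ⊕ Fin r) × Fin n → Prop) [DecidablePred p],
          #{x | p x} = #{x | part x = none ∧ p x} + ∑ k, #{x | part x = some k ∧ p x} := by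
        intro p _
        rw [card_eq_sum_card_fiberwise (f := part) (t := univ) (by simp), Fintype.sum_option]
        simp only [filter_filter, and_comm]
      rw [hsplit, hsplit fun x => x.2 = i, sum_congr rfl fun k _ => hsome k i] at htot
      exact Nat.add_right_cancel htot
    · exact hsome k i
  · have hsum : ∀ (p : ((Fin n × Fin q) ⊕ Fin r) × Fin n → Prop) [DecidablePred p],
        #{x | p x} = ∑ y : Fin n × Fin q, #{j | p (Sum.inl y, j)} +
          ∑ t : Fin r, #{j | p (Sum.inr t, j)} := by
      intro p _
      simp only [card_filter, Fintype.sum_prod_type, Fintype.sum_sum_type]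
    rw [hsum]
    refine Nat.add_le_add (le_of_eq ?_) ?_
    · have : ∀ y : Fin n × Fin q, #{j | a (Sum.inl y, j) ≠ v (part (Sum.inl y, j))} = y.1 := by
        rintro ⟨i, m⟩
        rw [← Fin.card_Iio i]
        congr 1
        ext j
        simp [part, v, h₁]
      simp only [this, Fintype.sum_prod_type, sum_const, card_univ, Fintype.card_fin, smul_eq_mul,
        ← mul_sum]
      rw [Fin.sum_univ_eq_sum_range fun i => i, sum_range_id]
    · rcases r with _ | r
      · simp
      rw [Fin.sum_univ_succ, add_comm]
      refine Nat.add_le_add ?_ ?_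
      · have : ∀ t : Fin r, #{j | a (Sum.inr t.succ, j) ≠ v (part (Sum.inr t.succ, j))} ≤ n - 1 := by
          intro t
          obtain ⟨j, hj, he⟩ := mem_image.1 ((hPim t.succ).symm ▸ hc t.succ)
          rw [Nat.le_sub_one_iff_lt hn]
          conv_rhs => rw [← Fintype.card_fin n]
          refine card_lt_univ_of_notMem (x := j) ?_
          simp [part, v, hj, he]
        refine (sum_le_sum fun t _ => this t).trans ?_
        simp
      -- In the first mixed group, agent `0` holds `r` of the `n` goods: its other goods are all in
      -- pure groups.
      · have hz := ha z
        rw [hsum, Fin.sum_univ_succ] at hz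
        have hzero : ∀ t : Fin r, #{j | a (Sum.inr t.succ, j) = z} = 0 := fun t => by
          rw [card_eq_zero, filter_eq_empty_iff]
          intro j _ hj
          simpa using h₂ t.succ j (by rw [hj])
        have hpure : ∑ y : Fin n × Fin q, #{j | a (Sum.inl y, j) = z} = q * n := by
          simp [Fintype.sum_prod_type_right, h₁, filter_const, apply_ite]
        rw [hpure, sum_congr rfl fun t _ => hzero t] at hz
        have hcompl := card_filter_add_card_filter_not (s := (univ : Finset (Fin n)))
          (fun j => a (Sum.inr 0, j) = z)
        have hv : ∀ j, v (part (Sum.inr 0, j)) = z := fun j => by simp [part, v]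
        simp only [hv, card_univ, Fintype.card_fin, sum_const_zero] at hcompl hz ⊢
        simp only [Nat.add_eq_zero_iff, one_ne_zero, and_false, if_false]
        simp only [ne_eq]
        omega

end Parts

/-! ### Assembling the bounds -/

theorem suffices_general {n : ℕ} (hn : 0 < n) (s : ℕ) : Suffices n s
    (s / n * (n * (n - 1) / 2) +
      ((s % n - 1) * (n - 1) + if s % n = 0 then 0 else n - s % n)) := by
  intro M _ _ _ I A hA
  obtain ⟨a, rfl⟩ := A.exists_eq_ofOwner
  have hcard : ∀ i, #{g | a g = i} = s / n * n + s % n := fun i => by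
    rw [Nat.div_add_mod']
    exact hA i
  have hr := Nat.mod_lt s hn
  generalize s / n = q at *
  generalize s % n = r at *
  obtain ⟨E₀, h₁, h₂⟩ := exists_groups hr a hcard
  obtain ⟨E, hE, hEF⟩ := I.exists_isEF1_of_groups E₀
  obtain ⟨part, v, hbal, hle⟩ := exists_balanced_parts hr (a ∘ E.symm)
    (fun i m j => h₁ _ i m (by rw [← hE]; simp)) (fun t j => h₂ _ t (by rw [← hE]; simp))
    (fun i => by rw [← hcard i]; exact card_equiv E.symm (by simp))
  obtain ⟨T, hT, hreach⟩ := reachedIn_of_balanced (part ∘ E) v (fun g => (E g).2) univ a (by simp)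
    (map_pair_eq_of_card _ _ _ _ fun k i => by
      refine Eq.trans ?_ ((hbal k i).trans ?_)
      · exact card_equiv E (by simp)
      · exact (card_equiv E (by simp)).symm)
  refine ⟨_, hEF, T, hT.trans (le_trans (le_of_eq ?_) hle), hreach⟩
  exact card_equiv E (by simp)

theorem f_le_of_suffices {n s k : ℕ} (h : Suffices n s k) : f n s ≤ k :=
  Nat.sInf_le h

end FairDivision

/-- The conjunct `IsLeast` says that `f n s` is well defined, i.e. that a smallest `k` exists. -/
theorem mainTheorem1 :
    (∀ n s q r : ℕ, 0 < n → 0 < s → q = s / n → r = s - q * n →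
      IsLeast {k : ℕ | FairDivision.Suffices n s k} (FairDivision.f n s) ∧
      (r = 0 → (FairDivision.f n s : ℝ) ≤ (s : ℝ) * ((n : ℝ) - 1) / 2) ∧
      (r ≠ 0 → (FairDivision.f n s : ℝ) ≤
        (s : ℝ) * ((n : ℝ) - 1) / 2 + (r : ℝ) * ((n : ℝ) - 3) / 2 + 1)) ∧
    (∀ s q r : ℕ, 0 < s → q = s / 2 → r = s - q * 2 →
      (FairDivision.f 2 s : ℝ) ≤ ((s : ℝ) - (r : ℝ)) / 2) := by
  refine ⟨fun n s q r hn _ hq hr => ?_, fun s q r hs hq hr => ?_⟩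
  · have hsuff := FairDivision.suffices_general hn s
    have hdm : s = s / n * n + s % n := (Nat.div_add_mod' s n).symm
    obtain rfl : r = s % n := by rw [hr, hq]; omega
    rw [← hq] at hsuff hdm
    have hlt := Nat.mod_lt s hn
    have hf := Nat.cast_le (α := ℝ).2 (FairDivision.f_le_of_suffices hsuff)
    have htri : ((n * (n - 1) / 2 : ℕ) : ℝ) = n * (n - 1) / 2 := by
      rw [Nat.cast_div (Nat.even_mul_pred_self n).two_dvd (by norm_num), Nat.cast_mul,
        Nat.cast_pred hn]
      norm_num
    have hs : (s : ℝ) = q * n + (s % n : ℕ) := by exact_mod_cast hdm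
    refine ⟨⟨Nat.sInf_mem ⟨_, hsuff⟩, fun k hk => FairDivision.f_le_of_suffices hk⟩, fun h0 => ?_, fun h0 => ?_⟩
    · rw [h0] at hf hs
      refine hf.trans (le_of_eq ?_)
      push_cast [htri]
      rw [hs]
      simp
      ring
    · refine hf.trans (le_of_eq ?_)
      rw [if_neg h0]
      push_cast [htri, Nat.cast_pred hn, Nat.cast_pred (Nat.pos_of_ne_zero h0),
        Nat.cast_sub hlt.le]
      rw [hs]
      ring
  · have hf := Nat.cast_le (α := ℝ).2 (FairDivision.f_le_of_suffices (FairDivision.suffices_two hs))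
    refine hf.trans (le_of_eq ?_)
    have h : s = s / 2 * 2 + r := by omega
    have h' : (s : ℝ) = (s / 2 : ℕ) * 2 + r := by exact_mod_cast h
    rw [h', eq_div_iff two_ne_zero]
    ring
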